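/- All trees are finite; vertices of degree $2$ are allowed. A weighted tree $\mathcal T=(T,w)$ is a tree $T$ with a function $w:E(T)\to\mathbb R$; its leaves are the vertices of degree $1$, $L(T)$ is its set of leaves, and its total weight is $D_{tot}(\mathcal T)=\sum_{e\in E(T)}w(e)$. For a set $I$ of vertices, $D_I(\mathcal T)$ is the sum of the weights of the edges of the minimal subtree of $T$ containing $I$. Let $[n]=\{1,\dots,n\}$. A family of real numbers $\{D_I\}$ indexed by the $k$-subsets $I$ of $[n]$ is l-treelike if there is a weighted tree $\mathcal T$ with $[n]\subseteq L(T)$ and $D_I(\mathcal T)=D_I$ for all $I$. A weighted tree $\mathcal T$ with $L(T)=[n]$ realizes the family if $D_I(\mathcal T)=D_I$ for all $I$. A tree is a pseudostar of kind $(n,k)$ if it has exactly $n$ leaves and each of its edges divides the set of leaves into two sets at least one of which has cardinality $\ge k$. **Theorem.** Let $k,n\in\mathbb N$ with $3\le k\le n-1$, let $\{D_I\}$ be an l-treelike family of real numbers indexed by the $k$-subsets of $[n]$, and let $U$ be the set of the weighted trees with leaf set $[n]$ that realize it. (i) If all the elements of $U$ are pseudostars of kind $(n,k)$ (which is the case,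 for instance, if $k\le n/2$), then $D_{tot}(\mathcal P)=D_{tot}(\mathcal P')$ for all $\mathcal P,\mathcal P'\in U$; in particular $$\inf_{\mathcal P\in U} D_{tot}(\mathcal P)=\sup_{\mathcal P\in U} D_{tot}(\mathcal P).$$ (ii) If some element of $U$ is not a pseudostar of kind $(n,k)$, then $$\inf_{\mathcal T\in U} D_{tot}(\mathcal T)=-\infty,\qquad \sup_{\mathcal T\in U} D_{tot}(\mathcal T)=+\infty.$$ -/

import Mathlib

universe u

/-- A finite tree `graph`, endowed with a real-valued function `w` on its set of edges. -/
structure WeightedTree : Type (u + 1) where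
  V : Type u
  finite : Finite V
  graph : SimpleGraph V
  isTree : graph.IsTree
  w : graph.edgeSet → ℝ

namespace WeightedTree

variable (T : WeightedTree.{u})

/-- The set of leaves: the vertices of degree `1`. -/
def leaves : Set T.V :=
  {v | (T.graph.neighborSet v).ncard = 1}

/-- The weight of a subgraph: the sum of the weights of its edges. -/
noncomputable def weight (H : T.graph.Subgraph) : ℝ :=
  ∑ᶠ e ∈ {e : T.graph.edgeSet | (e : Sym2 T.V) ∈ H.edgeSet}, T.w e

/-- The total weight. -/
noncomputable def totalWeight : ℝ :=
  T.weight ⊤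

/-- The minimal subtree containing a set `S` of vertices: the intersection of all the connected
subgraphs (that is, of all the subtrees) whose vertex set contains `S`. -/
def minimalSubtree (S : Set T.V) : T.graph.Subgraph :=
  sInf {H : T.graph.Subgraph | H.Connected ∧ S ⊆ H.verts}

/-- The multiweight `D_S`: the weight of the minimal subtree containing `S`. -/
noncomputable def multiweight (S : Set T.V) : ℝ :=
  T.weight (T.minimalSubtree S)

/-- The leaves that lie on the same side as `u` after the removal of the edge joining `u`
and `v`. -/
def leavesOnSide (u v : T.V) : Set T.V :=
  {x | x ∈ T.leaves ∧ (T.graph.deleteEdges {s(u, v)}).Reachable u x}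

/-- A pseudostar of kind `(n, k)`: there are `n` leaves, and each edge divides the set of leaves
into two sets at least one of which has at least `k` elements. -/
def IsPseudostar (n k : ℕ) : Prop :=
  T.leaves.ncard = n ∧
    ∀ u v : T.V, T.graph.Adj u v →
      k ≤ (T.leavesOnSide u v).ncard ∨ k ≤ (T.leavesOnSide v u).ncard

end WeightedTree

/-- A weighted tree in which `n` distinct leaves are named by the elements of `Fin n`.
There may be further leaves. -/
structure MarkedTree (n : ℕ) : Type (u + 1) extends WeightedTree.{u} where
  mark : Fin n → V
  mark_injective : Function.Injective mark
  mark_mem_leaves : ∀ i, mark i ∈ toWeightedTree.leaves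

namespace MarkedTree

variable {n : ℕ} (T : MarkedTree.{u} n)

/-- The named leaves are all the leaves, i.e. the leaf set is `[n]`. -/
def AllLeavesMarked : Prop :=
  T.leaves = Set.range T.mark

/-- The `k`-weights of the named leaves are the given real numbers. -/
def HasMultiweights {k : ℕ} (D : {I : Finset (Fin n) // I.card = k} → ℝ) : Prop :=
  ∀ I : {I : Finset (Fin n) // I.card = k}, T.multiweight (T.mark '' (I.1 : Set (Fin n))) = D I

end MarkedTree

/-- A family of real numbers indexed by the `k`-subsets of an `n`-set is l-treelike if it is the
family of the `k`-weights of `n` of the leaves of some weighted tree. -/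
def IsLTreelike {n k : ℕ} (D : {I : Finset (Fin n) // I.card = k} → ℝ) : Prop :=
  ∃ T : MarkedTree.{u} n, T.HasMultiweights D

/-- The weighted trees with leaf set `[n]` that realize the family `D`. -/
def realizations {n k : ℕ} (D : {I : Finset (Fin n) // I.card = k} → ℝ) :
    Set (MarkedTree.{u} n) :=
  {T | T.AllLeavesMarked ∧ T.HasMultiweights D}

/-! Rooted at a marked leaf `r`, a tree becomes a laminar family of subsets of `[n]`: each edge
gives the set of marks that it cuts off from `r`. `D_I` is the total weight of the splits dividing
`I`, so only the weighted splits matter.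

(i) For two realizations, compare the weights of the splits inducing `B | S \ B` on a set `S`. If
`S` has `k + 2` elements, counting the splits that do not divide `S \ {x, y}` gives, for the
differences, `p x + p y + q {x, y} = c`. By laminarity the pairs with `q ≠ 0` lie in a union of two
matchings, which forces `p = c / 2` and `q = 0` (`eq_half_of_matchings`). Induction on `S` extends
this to all splits with parts of sizes at least `2` and at least `k` (`splitWeight_eq`). For
pseudostars only the pendant splits can still differ. Their differences sum to the difference `c` of
the total weights, and so do those outside any `k`-set. Hence they equal a constant `γ` with `n γ =
c = (n - k) γ`, and `c = 0`.

(ii) In a tree that is not a pseudostar, some edge has fewer than `k` leaves on each side, hence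
divides every `k`-set. Adding `t` to its weight and `-t / k` to each pendant edge keeps every `D_I`
and changes the total by `t (1 - n / k)`, which is arbitrary as `k < n`. -/

namespace SimpleGraph

/-! ### Sides of an edge in a tree -/

variable {V : Type*} {G : SimpleGraph V}

/-- A walk from `x` using `e'` would pass through its endpoint `b`, which is out of reach once `e`
is removed. -/
lemma Reachable.deleteEdges_of_not_reachable {e e' : Sym2 V} {x y b : V}
    (h : (G.deleteEdges {e}).Reachable x y) (hb : ¬ (G.deleteEdges {e}).Reachable x b)
    (hbe : b ∈ e') : (G.deleteEdges {e'}).Reachable x y := by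
  classical
  obtain ⟨p⟩ := h
  refine ⟨(p.mapLe (G.deleteEdges_le {e})).toDeleteEdges {e'} ?_⟩
  intro f hf hfe
  rw [Set.mem_singleton_iff] at hfe
  subst hfe
  rw [Walk.edges_mapLe_eq_edges] at hf
  exact hb ⟨p.takeUntil b (Walk.mem_support_of_mem_edges hf hbe)⟩

lemma Preconnected.reachable_deleteEdges_or (hG : G.Preconnected) (u v x : V) :
    (G.deleteEdges {s(u, v)}).Reachable u x ∨ (G.deleteEdges {s(u, v)}).Reachable v x := by
  obtain ⟨p⟩ := hG x u
  induction p with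
  | nil => exact Or.inl .rfl
  | @cons x y z hxy p ih =>
    by_cases he : s(x, y) = s(z, v)
    · rcases Sym2.eq_iff.1 he with ⟨rfl, rfl⟩ | ⟨rfl, rfl⟩
      · exact Or.inl .rfl
      · exact Or.inr .rfl
    · have : (G.deleteEdges {s(z, v)}).Reachable y x :=
        Adj.reachable (by rw [deleteEdges_adj]; exact ⟨hxy.symm, by simpa [Sym2.eq_swap] using he⟩)
      exact ih.imp (fun h => h.trans this) (fun h => h.trans this)

lemma IsAcyclic.not_reachable_deleteEdges (hG : G.IsAcyclic) {u v : V} (h : G.Adj u v) :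
    ¬ (G.deleteEdges {s(u, v)}).Reachable u v := by
  have := isAcyclic_iff_forall_adj_isBridge.1 hG h
  rwa [isBridge_iff] at this

/-- The removal of an edge leaves at most two components. -/
lemma Preconnected.reachable_of_not_reachable (hG : G.Preconnected) (e : Sym2 V) {r x y : V}
    (hx : ¬ (G.deleteEdges {e}).Reachable r x) (hy : ¬ (G.deleteEdges {e}).Reachable r y) :
    (G.deleteEdges {e}).Reachable x y := by
  induction e with | h u v =>
  rcases hG.reachable_deleteEdges_or u v r with hr | hr <;>
  rcases hG.reachable_deleteEdges_or u v x with h1 | h1 <;>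
  rcases hG.reachable_deleteEdges_or u v y with h2 | h2 <;>
  first
  | exact h1.symm.trans h2
  | exact absurd (hr.symm.trans h1) hx
  | exact absurd (hr.symm.trans h2) hy

/-- The sides, opposite to a vertex `r`, of two edges of a connected graph form a laminar family. -/
lemma Preconnected.not_reachable_laminar (hG : G.Preconnected) (r : V) {e f : Sym2 V}
    (he : e ∈ G.edgeSet) (hf : f ∈ G.edgeSet) :
    (∀ x, ¬ (G.deleteEdges {e}).Reachable r x → (G.deleteEdges {f}).Reachable r x) ∨
    (∀ x, ¬ (G.deleteEdges {e}).Reachable r x → ¬ (G.deleteEdges {f}).Reachable r x) ∨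
    (∀ x, ¬ (G.deleteEdges {f}).Reachable r x → ¬ (G.deleteEdges {e}).Reachable r x) := by
  by_cases hef : e = f
  · subst hef; exact Or.inr (Or.inl fun _ h => h)
  induction e with | h a b =>
  have hab : (G.deleteEdges {f}).Reachable a b :=
    Adj.reachable (by rw [deleteEdges_adj]; exact ⟨he, hef⟩)
  -- The edge `e` lies wholly on one side of `f`. If that is the side of `r`, the far side of `f`
  -- stays connected without `e`; otherwise whatever `r` reaches without `f`, it reaches without
  -- `e`.
  by_cases hr : (G.deleteEdges {f}).Reachable r a
  · -- the side of `f` opposite to `r` contains no endpoint of the other edge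
    have key : ∀ x y, ¬ (G.deleteEdges {f}).Reachable r x → ¬ (G.deleteEdges {f}).Reachable r y →
        (G.deleteEdges {s(a, b)}).Reachable x y := fun x y hx hy =>
      (hG.reachable_of_not_reachable f hx hy).deleteEdges_of_not_reachable
        (fun h => hx (hr.trans h.symm)) (Sym2.mem_mk_left a b)
    by_cases hq : ∃ x, ¬ (G.deleteEdges {f}).Reachable r x ∧
      (G.deleteEdges {s(a, b)}).Reachable r x
    · obtain ⟨x, hx, hx'⟩ := hq
      left
      intro y hy
      by_contra hy'
      exact hy (hx'.trans (key x y hx hy'))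
    · push Not at hq
      exact Or.inr (Or.inr hq)
  · right; left
    have key : ∀ x, (G.deleteEdges {f}).Reachable r x → (G.deleteEdges {s(a, b)}).Reachable r x :=
      fun x hx => hx.deleteEdges_of_not_reachable hr (Sym2.mem_mk_left a b)
    exact fun x hx hx' => hx (key x hx')

/-- In a finite tree, each side of an edge contains a leaf. -/
lemma IsTree.exists_leaf_reachable [Finite V] (hG : G.IsTree) {a b : V} (hab : G.Adj a b) :
    ∃ x, (G.neighborSet x).ncard = 1 ∧ (G.deleteEdges {s(a, b)}).Reachable b x := by
  -- Induction on the size of the side of `b`: if `b` is not a leaf, a further neighbour `c` yields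
  -- the edge `bc`, whose side at `c` is smaller because it misses `b`.
  induction hN : {x | (G.deleteEdges {s(a, b)}).Reachable b x}.ncard using Nat.strong_induction_on
    generalizing a b with
  | _ N ih =>
  by_cases hb : (G.neighborSet b).ncard = 1
  · exact ⟨b, hb, .rfl⟩
  have hc : ∃ c, G.Adj b c ∧ c ≠ a := by
    by_contra! hc
    apply hb
    rw [Set.ncard_eq_one]
    exact ⟨a, Set.eq_singleton_iff_unique_mem.2 ⟨hab.symm, hc⟩⟩
  obtain ⟨c, hbc, hca⟩ := hc
  have hnb := hG.isAcyclic.not_reachable_deleteEdges hbc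
  have hmem : (G.deleteEdges {s(a, b)}).Reachable b c :=
    Adj.reachable (by
      rw [deleteEdges_adj]
      refine ⟨hbc, ?_⟩
      simp only [Set.mem_singleton_iff, Sym2.eq_iff, not_or, not_and]
      exact ⟨fun h => absurd h hab.ne.symm, fun _ h => hca h⟩)
  have hsub : ∀ x, (G.deleteEdges {s(b, c)}).Reachable c x →
      (G.deleteEdges {s(a, b)}).Reachable b x := fun x hx =>
    hmem.trans (hx.deleteEdges_of_not_reachable (fun h => hnb h.symm) (Sym2.mem_mk_right a b))
  obtain ⟨x, hx, hx'⟩ := ih _ (by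
    rw [← hN]
    refine Set.ncard_lt_ncard ⟨hsub, fun h => hnb ?_⟩ (Set.toFinite _)
    exact (h (show b ∈ {x | (G.deleteEdges {s(a, b)}).Reachable b x} from Reachable.rfl)).symm)
    hbc rfl
  exact ⟨x, hx, hsub x hx'⟩

/-- Deleting the edge at a leaf isolates the leaf. -/
lemma reachable_deleteEdges_leaf_iff {a x : V} {e : Sym2 V} (ha : (G.neighborSet a).ncard = 1)
    (he : e ∈ G.edgeSet) (hae : a ∈ e) : (G.deleteEdges {e}).Reachable a x ↔ a = x := by
  refine ⟨fun ⟨p⟩ => ?_, fun h => h ▸ .rfl⟩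
  cases p with
  | nil => rfl
  | @cons _ b _ h _ =>
    exfalso
    obtain ⟨c, rfl⟩ := hae
    obtain ⟨d, hd⟩ := Set.ncard_eq_one.1 ha
    rw [deleteEdges_adj] at h
    have h1 : b ∈ G.neighborSet a := h.1
    have h2 : c ∈ G.neighborSet a := he
    rw [hd, Set.mem_singleton_iff] at h1 h2
    exact h.2 (by simp [h1, h2])

end SimpleGraph

/-! ### Multiweights as sums over separating edges -/

namespace WeightedTree

variable (T : WeightedTree.{u})

noncomputable instance : Fintype T.graph.edgeSet :=
  have := T.finite
  Fintype.ofFinite _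

/-- An edge separates a set of vertices if its removal disconnects two of them. -/
def Separates (e : Sym2 T.V) (S : Set T.V) : Prop :=
  ∃ x ∈ S, ∃ y ∈ S, ¬ (T.graph.deleteEdges {e}).Reachable x y

open Classical in
lemma weight_eq_sum (H : T.graph.Subgraph) :
    T.weight H = ∑ e : T.graph.edgeSet, if (e : Sym2 T.V) ∈ H.edgeSet then T.w e else 0 := by
  rw [weight, finsum_mem_def, finsum_eq_sum_of_fintype]
  rfl

lemma totalWeight_eq_sum : T.totalWeight = ∑ e : T.graph.edgeSet, T.w e := by
  classical
  rw [totalWeight, weight_eq_sum]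
  exact Finset.sum_congr rfl fun e _ => if_pos (by simp)

/-- If `e` does not separate `S`, the component of the graph minus `e` that meets `S` is a connected
subgraph containing `S` and avoiding `e`. If `e` separates two points of `S`, every connected
subgraph through both uses `e`. -/
lemma mem_edgeSet_minimalSubtree_iff {S : Set T.V} (hS : S.Nonempty) (e : T.graph.edgeSet) :
    (e : Sym2 T.V) ∈ (T.minimalSubtree S).edgeSet ↔ T.Separates e S := by
  rw [minimalSubtree, SimpleGraph.Subgraph.edgeSet_sInf]
  constructor
  · rintro ⟨h, -⟩
    by_contra hsep
    obtain ⟨a, ha⟩ := hS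
    let H : T.graph.Subgraph :=
      { verts := {x | (T.graph.deleteEdges {(e : Sym2 T.V)}).Reachable a x}
        Adj := fun x y => (T.graph.deleteEdges {(e : Sym2 T.V)}).Reachable a x ∧
          (T.graph.deleteEdges {(e : Sym2 T.V)}).Adj x y
        adj_sub := fun h => SimpleGraph.deleteEdges_le _ h.2
        edge_vert := fun h => h.1
        symm := ⟨fun x y h => ⟨h.1.trans h.2.reachable, h.2.symm⟩⟩ }
    have hconn : H.Connected := by
      rw [SimpleGraph.Subgraph.connected_iff']
      have key : ∀ {y z} (_ : (T.graph.deleteEdges {(e : Sym2 T.V)}).Walk y z) (hy : y ∈ H.verts)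
          (hz : z ∈ H.verts), H.coe.Reachable ⟨y, hy⟩ ⟨z, hz⟩ := by
        intro y z p hy hz
        induction p with
        | nil => exact .rfl
        | cons h p ih =>
          have hv := SimpleGraph.Reachable.trans hy h.reachable
          have hadj : H.coe.Adj ⟨_, hy⟩ ⟨_, hv⟩ := ⟨hy, h⟩
          exact hadj.reachable.trans (ih hv hz)
      exact
        { preconnected := fun x y => by
            obtain ⟨p⟩ := x.2.symm.trans y.2
            exact key p x.2 y.2
          nonempty := ⟨⟨a, SimpleGraph.Reachable.rfl⟩⟩ }
    have hmem := Set.mem_iInter₂.1 h H ⟨hconn, fun x hx => by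
      by_contra hx'
      exact hsep ⟨a, ha, x, hx, hx'⟩⟩
    obtain ⟨e, he⟩ := e
    induction e with | h u v =>
    have := (SimpleGraph.Subgraph.mem_edgeSet.1 hmem).2
    rw [SimpleGraph.deleteEdges_adj] at this
    exact this.2 rfl
  · rintro ⟨x, hx, y, hy, hxy⟩
    refine ⟨Set.mem_iInter₂.2 fun H ⟨hH, hSH⟩ => ?_, e.2⟩
    by_contra he
    rw [SimpleGraph.Subgraph.connected_iff'] at hH
    obtain ⟨p⟩ := hH.preconnected ⟨x, hSH hx⟩ ⟨y, hSH hy⟩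
    refine hxy ⟨(p.map H.hom).toDeleteEdges {(e : Sym2 T.V)} ?_⟩
    rintro f hf rfl
    rw [SimpleGraph.Walk.edges_map] at hf
    obtain ⟨f', hf', hff⟩ := List.mem_map.1 hf
    apply he
    rw [← hff]
    have := p.edges_subset_edgeSet hf'
    induction f' with | h u v => exact this

open Classical in
lemma multiweight_eq_sum {S : Set T.V} (hS : S.Nonempty) :
    T.multiweight S = ∑ e : T.graph.edgeSet, if T.Separates e S then T.w e else 0 := by
  rw [multiweight, weight_eq_sum]
  exact Finset.sum_congr rfl fun e _ => by rw [T.mem_edgeSet_minimalSubtree_iff hS]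

end WeightedTree

/-! ### Weighted split systems -/

namespace SplitSystem

open Finset

variable {α E : Type*} [DecidableEq α] [Fintype E]

/-- The total weight of the splits `σ e | (σ e)ᶜ` that restrict on `S` to the split
`B | S \ B`. -/
def splitWeight (σ : E → Finset α) (w : E → ℝ) (S B : Finset α) : ℝ :=
  ∑ e, w e * ((if σ e ∩ S = B then 1 else 0) + if S \ σ e = B then 1 else 0)

/-- The total weight of the splits that divide `I`. -/
def cutWeight (σ : E → Finset α) (w : E → ℝ) (I : Finset α) : ℝ :=
  ∑ e, if ¬ I ⊆ σ e ∧ ¬ Disjoint I (σ e) then w e else 0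

/-- A family of sets that are pairwise nested or disjoint. -/
def Laminar (σ : E → Finset α) : Prop :=
  ∀ e f, Disjoint (σ e) (σ f) ∨ σ e ⊆ σ f ∨ σ f ⊆ σ e

/-- Compatibility of the splits `A | S \ A` and `B | S \ B`. -/
def Compatible (S A B : Finset α) : Prop :=
  Disjoint A B ∨ A ⊆ B ∨ B ⊆ A ∨ S ⊆ A ∪ B

variable {σ : E → Finset α} {w : E → ℝ} {S B I : Finset α}

/-- A split inducing `B | S \ B` puts the new point `x` either opposite to `B` or together with `B`.
-/
lemma splitWeight_insert {x : α} (hx : x ∉ S) (hB : B ⊆ S) :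
    splitWeight σ w S B =
      splitWeight σ w (insert x S) B + splitWeight σ w (insert x S) (insert x B) := by
  rw [splitWeight, splitWeight, splitWeight, ← sum_add_distrib]
  refine sum_congr rfl fun e _ => ?_
  rw [← mul_add]
  congr 1
  have hxB : x ∉ B := fun h => hx (hB h)
  have h1 : ∀ X : Finset α, insert x X ≠ B := fun X h => hxB (h ▸ mem_insert_self x X)
  have h2 : ∀ X : Finset α, x ∉ X → X ≠ insert x B := fun X h h' =>
    h (h' ▸ mem_insert_self x B)
  have h3 : ∀ X : Finset α, x ∉ X → (insert x X = insert x B ↔ X = B) := fun X h =>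
    ⟨fun h' => by rw [← erase_insert h, h', erase_insert hxB], fun h' => by rw [h']⟩
  have hi : x ∉ σ e ∩ S := fun h => hx (mem_inter.1 h).2
  have hd : x ∉ S \ σ e := fun h => hx (mem_sdiff.1 h).1
  by_cases hxe : x ∈ σ e
  · rw [inter_insert_of_mem hxe, insert_sdiff_of_mem _ hxe]
    simp only [h1, h2 _ hd, h3 _ hi, if_false]
    ring
  · rw [inter_insert_of_notMem hxe, insert_sdiff_of_notMem _ hxe]
    simp only [h1, h2 _ hi, h3 _ hd, if_false]
    ring

lemma splitWeight_sdiff (hB : B ⊆ S) : splitWeight σ w S (S \ B) = splitWeight σ w S B := by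
  refine sum_congr rfl fun e _ => ?_
  have h1 : σ e ∩ S = S \ B ↔ S \ σ e = B := by
    simp only [Finset.ext_iff, mem_inter, mem_sdiff]
    exact forall_congr' fun x => by have := @hB x; tauto
  have h2 : S \ σ e = S \ B ↔ σ e ∩ S = B := by
    simp only [Finset.ext_iff, mem_inter, mem_sdiff]
    exact forall_congr' fun x => by have := @hB x; tauto
  simp only [h1, h2, add_comm]

lemma exists_of_splitWeight_ne_zero (h : splitWeight σ w S B ≠ 0) :
    ∃ e, σ e ∩ S = B ∨ S \ σ e = B := by
  obtain ⟨e, -, he⟩ := exists_ne_zero_of_sum_ne_zero h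
  refine ⟨e, ?_⟩
  by_contra! hne
  exact he (by simp [hne.1, hne.2])

lemma Laminar.compatible (hσ : Laminar σ) {A : Finset α} (hA : splitWeight σ w S A ≠ 0)
    (hB : splitWeight σ w S B ≠ 0) : Compatible S A B := by
  obtain ⟨e, he⟩ := exists_of_splitWeight_ne_zero hA
  obtain ⟨f, hf⟩ := exists_of_splitWeight_ne_zero hB
  unfold Compatible
  have := hσ e f
  simp only [Finset.disjoint_left, Finset.subset_iff, mem_union] at this ⊢
  rcases he with rfl | rfl <;> rcases hf with rfl | rfl <;>
    simp only [mem_inter, mem_sdiff] <;>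
    rcases this with h | h | h <;>
    grind

/-- A split that does not divide `I` has exactly one side containing `I` and is counted once, at the
trace of that side on `S`; a split dividing `I` is never counted. -/
lemma sum_splitWeight_superset (hIS : I ⊆ S) (hI : I.Nonempty) :
    ∑ A ∈ S.powerset with I ⊆ A, splitWeight σ w S A = ∑ e, w e - cutWeight σ w I := by
  simp only [splitWeight, cutWeight]
  rw [sum_comm, ← sum_sub_distrib]
  refine sum_congr rfl fun e _ => ?_
  rw [← mul_sum, sum_add_distrib, sum_ite_eq, sum_ite_eq]
  have h1 : σ e ∩ S ∈ S.powerset.filter (I ⊆ ·) ↔ I ⊆ σ e := by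
    simp only [mem_filter, mem_powerset, inter_subset_right, true_and, subset_inter_iff, hIS,
      and_true]
  have h2 : S \ σ e ∈ S.powerset.filter (I ⊆ ·) ↔ Disjoint I (σ e) := by
    simp only [mem_filter, mem_powerset, sdiff_subset, true_and, subset_sdiff, hIS]
  simp only [h1, h2]
  obtain ⟨i, hi⟩ := hI
  by_cases h3 : I ⊆ σ e
  · have h4 : ¬ Disjoint I (σ e) := fun h => disjoint_left.1 h hi (h3 hi)
    simp [h3, h4]
  · by_cases h4 : Disjoint I (σ e) <;> simp [h3, h4]

/-- If the edges of a graph on at least five vertices are coloured with two colours, each of them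
a matching, and `p x + p y = c` for all non-adjacent `x`, `y`, then `p = c / 2`. -/
lemma eq_half_of_matchings {P Q : α → α → Prop} {p : α → ℝ} {c : ℝ}
    (hPs : ∀ x y, P x y → P y x) (hQs : ∀ x y, Q x y → Q y x)
    (hS : 5 ≤ S.card)
    (hP : ∀ x ∈ S, ∀ y ∈ S, ∀ z ∈ S, x ≠ y → x ≠ z → P x y → P x z → y = z)
    (hQ : ∀ x ∈ S, ∀ y ∈ S, ∀ z ∈ S, x ≠ y → x ≠ z → Q x y → Q x z → y = z)
    (hp : ∀ x ∈ S, ∀ y ∈ S, x ≠ y → p x + p y = c ∨ P x y ∨ Q x y) :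
    ∀ x ∈ S, p x = c / 2 := by
  -- Call a pair bad if its `p`-sum differs from `c`. Bad pairs are covered by two matchings, so no
  -- vertex is in three of them and they contain no odd cycle.
  have star : ∀ x ∈ S, ∀ a ∈ S, ∀ b ∈ S, ∀ d ∈ S, x ≠ a → x ≠ b → x ≠ d → a ≠ b → a ≠ d →
      b ≠ d → p x + p a = c ∨ p x + p b = c ∨ p x + p d = c := by
    intro x hx a ha b hb d hd _ _ _ _ _ _
    have := hp x hx a ha; have := hp x hx b hb; have := hp x hx d hd
    have := hP x hx; have := hQ x hx
    grind
  have tri : ∀ a ∈ S, ∀ b ∈ S, ∀ d ∈ S, a ≠ b → a ≠ d → b ≠ d →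
      p a + p b = c ∨ p a + p d = c ∨ p b + p d = c := by
    intro a ha b hb d hd _ _ _
    have := hp a ha b hb; have := hp a ha d hd; have := hp b hb d hd
    have := hP a ha; have := hQ a ha; have := hP b hb; have := hQ b hb
    have := hP d hd; have := hQ d hd
    grind
  -- On five vertices, a graph with neither a triangle nor three independent vertices is a 5-cycle,
  -- which two matchings cannot cover. So some three vertices have no bad pair.
  have indep : ∃ a ∈ S, ∃ b ∈ S, ∃ d ∈ S, a ≠ b ∧ a ≠ d ∧ b ≠ d ∧
      p a + p b = c ∧ p a + p d = c ∧ p b + p d = c := by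
    by_contra! hno
    have cycle : ∀ a ∈ S, ∀ e ∈ S, ∀ d ∈ S, ∀ b ∈ S, ∀ f ∈ S, [a, e, d, b, f].Nodup →
        ¬ (p a + p e ≠ c ∧ p e + p d ≠ c ∧ p d + p b ≠ c ∧ p b + p f ≠ c ∧ p f + p a ≠ c) := by
      intro a ha e he d hd b hb f hf hnd ⟨h1, h2, h3, h4, h5⟩
      simp only [List.nodup_cons, List.mem_cons, List.not_mem_nil, or_false, not_or] at hnd
      obtain ⟨⟨n1, n2, n3, n4⟩, ⟨n5, n6, n7⟩, ⟨n8, n9⟩, n10, -⟩ := hnd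
      have c1 := (hp a ha e he n1).resolve_left h1
      have c2 := (hp e he d hd n5).resolve_left h2
      have c3 := (hp d hd b hb n8).resolve_left h3
      have c4 := (hp b hb f hf n10).resolve_left h4
      have c5 := (hp f hf a ha (Ne.symm n4)).resolve_left h5
      have e1 : ¬ (P a e ∧ P e d) := fun h =>
        n2 (hP e he a ha d hd (Ne.symm n1) n5 (hPs _ _ h.1) h.2)
      have e2 : ¬ (P e d ∧ P d b) := fun h =>
        n6 (hP d hd e he b hb (Ne.symm n5) n8 (hPs _ _ h.1) h.2)
      have e3 : ¬ (P d b ∧ P b f) := fun h =>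
        n9 (hP b hb d hd f hf (Ne.symm n8) n10 (hPs _ _ h.1) h.2)
      have e4 : ¬ (P b f ∧ P f a) := fun h =>
        n3 (hP f hf b hb a ha (Ne.symm n10) (Ne.symm n4) (hPs _ _ h.1) h.2).symm
      have e5 : ¬ (P f a ∧ P a e) := fun h =>
        n7 (hP a ha f hf e he n4 n1 (hPs _ _ h.1) h.2).symm
      have f1 : ¬ (Q a e ∧ Q e d) := fun h =>
        n2 (hQ e he a ha d hd (Ne.symm n1) n5 (hQs _ _ h.1) h.2)
      have f2 : ¬ (Q e d ∧ Q d b) := fun h =>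
        n6 (hQ d hd e he b hb (Ne.symm n5) n8 (hQs _ _ h.1) h.2)
      have f3 : ¬ (Q d b ∧ Q b f) := fun h =>
        n9 (hQ b hb d hd f hf (Ne.symm n8) n10 (hQs _ _ h.1) h.2)
      have f4 : ¬ (Q b f ∧ Q f a) := fun h =>
        n3 (hQ f hf b hb a ha (Ne.symm n10) (Ne.symm n4) (hQs _ _ h.1) h.2).symm
      have f5 : ¬ (Q f a ∧ Q a e) := fun h =>
        n7 (hQ a ha f hf e he n4 n1 (hQs _ _ h.1) h.2).symm
      rcases c1 with h | h
      · have q2 := c2.resolve_left fun h' => e1 ⟨h, h'⟩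
        have q3 := c3.resolve_right fun h' => f2 ⟨q2, h'⟩
        have q4 := c4.resolve_left fun h' => e3 ⟨q3, h'⟩
        have q5 := c5.resolve_right fun h' => f4 ⟨q4, h'⟩
        exact e5 ⟨q5, h⟩
      · have q2 := c2.resolve_right fun h' => f1 ⟨h, h'⟩
        have q3 := c3.resolve_left fun h' => e2 ⟨q2, h'⟩
        have q4 := c4.resolve_right fun h' => f3 ⟨q3, h'⟩
        have q5 := c5.resolve_left fun h' => e4 ⟨q4, h'⟩
        exact f5 ⟨q5, h⟩
    -- If `ab` and `ad` are good, then `bd`, `ae`, `af` are bad and `ef` is good; the remaining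
    -- pairs close up a bad 5-cycle through `a`.
    have core : ∀ a ∈ S, ∀ b ∈ S, ∀ d ∈ S, ∀ e ∈ S, ∀ f ∈ S, [a, b, d, e, f].Nodup →
        p a + p b = c → p a + p d ≠ c := by
      intro a ha b hb d hd e he f hf hnd h1 h2
      simp only [List.nodup_cons, List.mem_cons, List.not_mem_nil, or_false, not_or] at hnd
      obtain ⟨⟨n1, n2, n3, n4⟩, ⟨n5, n6, n7⟩, ⟨n8, n9⟩, n10, -⟩ := hnd
      have hbd := hno a ha b hb d hd n1 n2 n5 h1 h2
      have hae : p a + p e ≠ c := fun h => by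
        rcases tri b hb d hd e he n5 n6 n8 with h' | h' | h'
        exacts [hbd h', hno a ha b hb e he n1 n3 n6 h1 h h', hno a ha d hd e he n2 n3 n8 h2 h h']
      have haf : p a + p f ≠ c := fun h => by
        rcases tri b hb d hd f hf n5 n7 n9 with h' | h' | h'
        exacts [hbd h', hno a ha b hb f hf n1 n4 n7 h1 h h', hno a ha d hd f hf n2 n4 n9 h2 h h']
      have hef : p e + p f = c :=
        ((tri a ha e he f hf n3 n4 n10).resolve_left hae).resolve_left haf
      have hb' := hno b hb e he f hf n6 n7 n10
      have hd' := hno d hd e he f hf n8 n9 n10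
      have hte := tri b hb d hd e he n5 n6 n8
      have htf := tri b hb d hd f hf n5 n7 n9
      have hse := star b hb d hd e he f hf n5 n6 n7 n8 n9 n10
      have hsd := star d hd b hb e he f hf (Ne.symm n5) n8 n9 n6 n7 n10
      rw [add_comm (p d) (p b)] at hsd
      have cyc1 := cycle a ha e he d hd b hb f hf (by
        clear * - n1 n2 n3 n4 n5 n6 n7 n8 n9 n10
        simp only [List.nodup_cons, List.mem_cons, List.not_mem_nil, or_false, not_or]
        grind)
      have cyc2 := cycle a ha e he b hb d hd f hf (by
        clear * - n1 n2 n3 n4 n5 n6 n7 n8 n9 n10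
        simp only [List.nodup_cons, List.mem_cons, List.not_mem_nil, or_false, not_or]
        grind)
      rw [add_comm (p f) (p a), add_comm (p e) (p d), add_comm (p d) (p b)] at cyc1
      rw [add_comm (p f) (p a), add_comm (p e) (p b)] at cyc2
      clear * - hef hae haf hbd hb' hd' hse hsd hte htf cyc1 cyc2
      grind only
    obtain ⟨U, hUS, hU⟩ := exists_subset_card_eq hS
    let v : Fin 5 → α := fun i => (U.equivFinOfCardEq hU).symm i
    have hv : Function.Injective v :=
      Subtype.val_injective.comp (U.equivFinOfCardEq hU).symm.injective
    have hvS : ∀ i, v i ∈ S := fun i => hUS ((U.equivFinOfCardEq hU).symm i).2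
    have core' : ∀ i j k l m : Fin 5, [i, j, k, l, m].Nodup → p (v i) + p (v j) = c →
        p (v i) + p (v k) ≠ c := fun i j k l m h =>
      core _ (hvS i) _ (hvS j) _ (hvS k) _ (hvS l) _ (hvS m) (h.map hv)
    have star' : ∀ i j k l : Fin 5, [i, j, k, l].Nodup → p (v i) + p (v j) = c ∨
        p (v i) + p (v k) = c ∨ p (v i) + p (v l) = c := by
      intro i j k l h
      have h' := h.map hv
      simp only [List.map_cons, List.map_nil, List.nodup_cons, List.mem_cons, List.not_mem_nil,
        or_false, not_or] at h'
      exact star _ (hvS i) _ (hvS j) _ (hvS k) _ (hvS l) h'.1.1 h'.1.2.1 h'.1.2.2 h'.2.1.1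
        h'.2.1.2 h'.2.2.1
    -- By `star'` each vertex has two good partners among the other four, contrary to `core'`.
    rcases star' 0 1 2 3 (by decide) with h | h | h
    · rcases star' 0 2 3 4 (by decide) with h' | h' | h'
      exacts [core' 0 1 2 3 4 (by decide) h h', core' 0 1 3 2 4 (by decide) h h',
        core' 0 1 4 2 3 (by decide) h h']
    · rcases star' 0 1 3 4 (by decide) with h' | h' | h'
      exacts [core' 0 2 1 3 4 (by decide) h h', core' 0 2 3 1 4 (by decide) h h',
        core' 0 2 4 1 3 (by decide) h h']
    · rcases star' 0 1 2 4 (by decide) with h' | h' | h'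
      exacts [core' 0 3 1 2 4 (by decide) h h', core' 0 3 2 1 4 (by decide) h h',
        core' 0 3 4 1 2 (by decide) h h']
  obtain ⟨a, ha, b, hb, d, hd, hab, had, hbd, h1, h2, h3⟩ := indep
  intro x hx
  by_cases hxa : x = a
  · subst hxa; linarith
  by_cases hxb : x = b
  · subst hxb; linarith
  by_cases hxd : x = d
  · subst hxd; linarith
  rcases star x hx a ha b hb d hd hxa hxb hxd hab had hbd with h | h | h <;> linarith

end SplitSystem

/-! ### Splits determined by the `k`-weights -/

namespace SplitSystem

open Finset

lemma sum_card_eq_one {α : Type*} [Fintype α] (F : Finset α → ℝ) :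
    ∑ A : Finset α, (if A.card = 1 then F A else 0) = ∑ x, F {x} := by
  rw [← sum_filter]
  symm
  refine sum_nbij (fun x => {x}) (fun x _ => by simp) (fun x _ y _ h => singleton_injective h)
    (fun A hA => ?_) (fun _ _ => rfl)
  obtain ⟨x, rfl⟩ := card_eq_one.1 (mem_filter.1 hA).2
  exact ⟨x, mem_coe.2 (mem_univ x), rfl⟩

section

variable {α : Type*} [DecidableEq α] {S : Finset α}

lemma sum_superset_sdiff_pair {x y : α} (hx : x ∈ S) (hy : y ∈ S) (hxy : x ≠ y)
    (F : Finset α → ℝ) :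
    ∑ A ∈ S.powerset with S \ {x, y} ⊆ A, F A =
      F S + F (S.erase x) + F (S.erase y) + F (S \ {x, y}) := by
  have h : S.powerset.filter (S \ {x, y} ⊆ ·) = {S, S.erase x, S.erase y, S \ {x, y}} := by
    ext A
    simp only [mem_filter, mem_powerset, mem_insert, mem_singleton, Finset.ext_iff, subset_iff,
      mem_sdiff, mem_erase, not_or]
    constructor
    · rintro ⟨h1, h2⟩
      by_cases hxA : x ∈ A <;> by_cases hyA : y ∈ A
      · left; grind
      · right; right; left; grind
      · right; left; grind
      · right; right; right; grind
    · rintro (h | h | h | h) <;> grind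
  have e1 : S ∉ ({S.erase x, S.erase y, S \ {x, y}} : Finset (Finset α)) := by
    simp only [mem_insert, mem_singleton, Finset.ext_iff, mem_erase, mem_sdiff]
    grind
  have e2 : S.erase x ∉ ({S.erase y, S \ {x, y}} : Finset (Finset α)) := by
    simp only [mem_insert, mem_singleton, Finset.ext_iff, mem_erase, mem_sdiff]
    grind
  have e3 : S.erase y ∉ ({S \ {x, y}} : Finset (Finset α)) := by
    simp only [mem_singleton, Finset.ext_iff, mem_erase, mem_sdiff, mem_insert]
    grind
  rw [h, sum_insert e1, sum_insert e2, sum_insert e3, sum_singleton]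
  ring

/-- Two pairs with a common element cannot cover five points. Hence the pairs of nonzero split
weight in one laminar system form a matching. -/
lemma Compatible.eq_of_pair {x y z : α} (hS : 5 ≤ S.card) (hxy : x ≠ y) (hxz : x ≠ z)
    (h : Compatible S {x, y} {x, z}) : y = z := by
  rcases h with h | h | h | h
  · exact absurd (mem_insert_self x _) (disjoint_left.1 h (mem_insert_self x _))
  · have := h (mem_insert_of_mem (mem_singleton_self y))
    simp only [mem_insert, mem_singleton] at this
    exact this.resolve_left hxy.symm
  · have := h (mem_insert_of_mem (mem_singleton_self z))
    simp only [mem_insert, mem_singleton] at this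
    exact (this.resolve_left hxz.symm).symm
  · have h1 := card_le_card h
    have h2 := card_union_le ({x, y} : Finset α) {x, z}
    rw [card_pair hxy, card_pair hxz] at h2
    omega

/-- In one laminar system, at most one one-point enlargement of `B` has nonzero split weight. -/
lemma Compatible.eq_of_insert {B : Finset α} {x y : α} (hB : B.Nonempty)
    (hx : x ∈ S \ B) (hy : y ∈ S \ B) (hS : 3 ≤ (S \ B).card)
    (h : Compatible S (insert x B) (insert y B)) : x = y := by
  obtain ⟨b, hb⟩ := hB
  rw [mem_sdiff] at hx hy
  rcases h with h | h | h | h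
  · exact absurd (mem_insert_of_mem hb) (disjoint_left.1 h (mem_insert_of_mem hb))
  · exact (mem_insert.1 (h (mem_insert_self x B))).resolve_right hx.2
  · exact ((mem_insert.1 (h (mem_insert_self y B))).resolve_right hy.2).symm
  · exfalso
    have : S \ B ⊆ {x, y} := fun z hz => by
      have := h (mem_sdiff.1 hz).1
      have := (mem_sdiff.1 hz).2
      grind
    have := (card_le_card this).trans card_le_two
    omega

end

variable {α E₁ E₂ : Type*} [DecidableEq α] [Fintype E₁] [Fintype E₂]
  {σ₁ : E₁ → Finset α} {σ₂ : E₂ → Finset α} {w₁ : E₁ → ℝ} {w₂ : E₂ → ℝ} {k : ℕ}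

/-- With `S` of size `k + 2`, each `S \ {x, y}` is a `k`-set with only four supersets in `S`, so
equality of the cut weights is a relation between two values of `p` and one pair weight. -/
lemma splitWeight_pair_eq (h₁ : Laminar σ₁) (h₂ : Laminar σ₂) (hk : 3 ≤ k)
    (hD : ∀ I : Finset α, I.card = k → cutWeight σ₁ w₁ I = cutWeight σ₂ w₂ I)
    {S : Finset α} (hS : S.card = k + 2) {x y : α} (hx : x ∈ S) (hy : y ∈ S) (hxy : x ≠ y) :
    splitWeight σ₁ w₁ S {x, y} = splitWeight σ₂ w₂ S {x, y} := by
  set p : α → ℝ := fun x =>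
    splitWeight σ₁ w₁ S (S.erase x) - splitWeight σ₂ w₂ S (S.erase x) with hp
  set c : ℝ := (∑ e, w₁ e - ∑ e, w₂ e) - (splitWeight σ₁ w₁ S S - splitWeight σ₂ w₂ S S) with hc
  have rel : ∀ x ∈ S, ∀ y ∈ S, x ≠ y →
      p x + p y + (splitWeight σ₁ w₁ S {x, y} - splitWeight σ₂ w₂ S {x, y}) = c := by
    intro x hx y hy hxy
    have hsub : {x, y} ⊆ S := insert_subset hx (singleton_subset_iff.2 hy)
    have hcard : (S \ {x, y}).card = k := by
      rw [card_sdiff_of_subset hsub, card_pair hxy, hS, Nat.add_sub_cancel]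
    have hne : (S \ {x, y}).Nonempty := card_pos.1 (by omega)
    have e₁ := sum_splitWeight_superset (σ := σ₁) (w := w₁) sdiff_subset hne
    have e₂ := sum_splitWeight_superset (σ := σ₂) (w := w₂) sdiff_subset hne
    rw [sum_superset_sdiff_pair hx hy hxy, splitWeight_sdiff hsub] at e₁ e₂
    rw [hD _ hcard] at e₁
    simp only [hp, hc]
    linarith
  have half := eq_half_of_matchings (S := S) (p := p) (c := c)
    (P := fun x y => splitWeight σ₁ w₁ S {x, y} ≠ 0)
    (Q := fun x y => splitWeight σ₂ w₂ S {x, y} ≠ 0)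
    (fun x y h => by rwa [pair_comm]) (fun x y h => by rwa [pair_comm]) (by omega)
    (fun x _ y _ z _ hxy hxz h h' => (h₁.compatible h h').eq_of_pair (by omega) hxy hxz)
    (fun x _ y _ z _ hxy hxz h h' => (h₂.compatible h h').eq_of_pair (by omega) hxy hxz)
    (fun x hx y hy hxy => by
      have := rel x hx y hy hxy
      by_contra! h
      rw [h.2.1, h.2.2] at this
      exact h.1 (by linarith))
  have := rel x hx y hy hxy
  rw [half x hx, half y hy] at this
  linarith

/-- The `k`-weights determine the weights of the splits one of whose sides has at least `k`
elements and the other one at least two. -/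
theorem splitWeight_eq (h₁ : Laminar σ₁) (h₂ : Laminar σ₂) (hk : 3 ≤ k)
    (hD : ∀ I : Finset α, I.card = k → cutWeight σ₁ w₁ I = cutWeight σ₂ w₂ I)
    (S B : Finset α) (hBS : B ⊆ S) (hB : 2 ≤ B.card) (hkS : k ≤ (S \ B).card) :
    splitWeight σ₁ w₁ S B = splitWeight σ₂ w₂ S B := by
  induction S using Finset.strongInduction generalizing B with
  | H S ih =>
  -- By induction on `S.erase x`, the sum of the weights at `B` and `insert x B` agrees in the two
  -- systems. If the weights at `B` differed, every `x ∈ S \ B` would need a nonzero weight at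
  -- `insert x B` in some system, but each system allows one such `x` and there are at least three.
  have large : ∀ B ⊆ S, 2 ≤ B.card → k + 1 ≤ (S \ B).card →
      splitWeight σ₁ w₁ S B = splitWeight σ₂ w₂ S B := by
    intro B hBS hB hkS
    by_contra hne
    have step : ∀ x ∈ S \ B,
        splitWeight σ₁ w₁ S (insert x B) ≠ 0 ∨ splitWeight σ₂ w₂ S (insert x B) ≠ 0 := by
      intro x hx
      obtain ⟨hxS, hxB⟩ := mem_sdiff.1 hx
      have hsub : B ⊆ S.erase x := subset_erase.2 ⟨hBS, hxB⟩
      have hIH := ih (S.erase x) (erase_ssubset hxS) B hsub hB (by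
        rw [erase_sdiff_comm, card_erase_of_mem hx]; omega)
      rw [splitWeight_insert (notMem_erase x S) hsub,
        splitWeight_insert (notMem_erase x S) hsub, insert_erase hxS] at hIH
      by_contra! h
      rw [h.1, h.2] at hIH
      exact hne (by linarith)
    obtain ⟨x, y, z, hx, hy, hz, hxy, hxz, hyz⟩ := two_lt_card_iff.1
      (show 2 < (S \ B).card by omega)
    have hBne : B.Nonempty := card_pos.1 (by omega)
    have key₁ : ∀ x ∈ S \ B, ∀ y ∈ S \ B, splitWeight σ₁ w₁ S (insert x B) ≠ 0 →
        splitWeight σ₁ w₁ S (insert y B) ≠ 0 → x = y := fun x hx y hy h h' =>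
      (h₁.compatible h h').eq_of_insert hBne hx hy (by omega)
    have key₂ : ∀ x ∈ S \ B, ∀ y ∈ S \ B, splitWeight σ₂ w₂ S (insert x B) ≠ 0 →
        splitWeight σ₂ w₂ S (insert y B) ≠ 0 → x = y := fun x hx y hy h h' =>
      (h₂.compatible h h').eq_of_insert hBne hx hy (by omega)
    rcases step x hx with h | h <;> rcases step y hy with h' | h' <;>
      rcases step z hz with h'' | h'' <;>
    first
    | exact hxy (key₁ x hx y hy h h')
    | exact hxy (key₂ x hx y hy h h')
    | exact hxz (key₁ x hx z hz h h'')
    | exact hxz (key₂ x hx z hz h h'')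
    | exact hyz (key₁ y hy z hz h' h'')
    | exact hyz (key₂ y hy z hz h' h'')
  rcases hkS.lt_or_eq with hlt | heq
  · exact large B hBS hB hlt
  rcases hB.lt_or_eq with hlt | heq'
  -- Removing `x` from both `S` and `B` keeps `S \ B`; the extra term at `B.erase x` has a
  -- complement of size `k + 1` and falls under `large`.
  · obtain ⟨x, hx⟩ := card_pos.1 (show 0 < B.card by omega)
    have hxS := hBS hx
    have hsub : B.erase x ⊆ S.erase x := erase_subset_erase x hBS
    have hc : (B.erase x).card = B.card - 1 := card_erase_of_mem hx
    have hs : S.erase x \ B.erase x = S \ B := by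
      ext z
      simp only [mem_sdiff, mem_erase]
      have : x ∈ B := hx
      grind
    have hIH := ih (S.erase x) (erase_ssubset hxS) (B.erase x) hsub (by omega)
      (by rw [hs]; exact hkS)
    rw [splitWeight_insert (notMem_erase x S) hsub,
      splitWeight_insert (notMem_erase x S) hsub, insert_erase hxS, insert_erase hx] at hIH
    have hl := large (B.erase x) ((erase_subset x B).trans hBS) (by omega) (by
      have h1 := card_sdiff_of_subset hBS
      have h2 := card_sdiff_of_subset ((erase_subset x B).trans hBS)
      have h3 := card_le_card hBS
      omega)
    linarith
  · obtain ⟨x, y, hxy, rfl⟩ := card_eq_two.1 heq'.symm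
    have hS : S.card = k + 2 := by
      have h1 := card_sdiff_of_subset hBS
      have h3 := card_le_card hBS
      omega
    exact splitWeight_pair_eq h₁ h₂ hk hD hS (hBS (mem_insert_self x _))
      (hBS (mem_insert_of_mem (mem_singleton_self y))) hxy

lemma sum_compl [Fintype α] (F : Finset α → ℝ) : ∑ A : Finset α, F Aᶜ = ∑ A, F A :=
  Equiv.sum_comp (Function.Involutive.toPerm compl compl_involutive) F

lemma sum_splitWeight_univ [Fintype α] :
    ∑ A : Finset α, splitWeight σ₁ w₁ univ A = 2 * ∑ e, w₁ e := by
  simp only [splitWeight]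
  rw [sum_comm, mul_sum]
  refine sum_congr rfl fun e _ => ?_
  rw [← mul_sum, sum_add_distrib, sum_ite_eq, sum_ite_eq, if_pos (mem_univ _),
    if_pos (mem_univ _)]
  ring

lemma card_of_splitWeight_univ_ne_zero [Fintype α]
    (ne₁ : ∀ e, (σ₁ e).Nonempty ∧ σ₁ e ≠ univ) (hp₁ : ∀ e, k ≤ (σ₁ e).card ∨ k ≤ (σ₁ e)ᶜ.card)
    {B : Finset α} (hB : splitWeight σ₁ w₁ univ B ≠ 0) :
    1 ≤ B.card ∧ 1 ≤ Bᶜ.card ∧ (k ≤ B.card ∨ k ≤ Bᶜ.card) := by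
  obtain ⟨e, he⟩ := exists_of_splitWeight_ne_zero hB
  have h1 : 1 ≤ (σ₁ e).card := card_pos.2 (ne₁ e).1
  have h2 : 1 ≤ (σ₁ e)ᶜ.card := card_pos.2 <| nonempty_iff_ne_empty.2 fun h =>
    (ne₁ e).2 ((compl_eq_empty_iff _).1 h)
  rw [inter_univ, ← compl_eq_univ_sdiff] at he
  rcases he with rfl | rfl
  · exact ⟨h1, h2, hp₁ e⟩
  · rw [compl_compl]
    exact ⟨h2, h1, (hp₁ e).symm⟩

/-- If each split has a side with at least `k` elements, then the `k`-weights determine the total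
weight. -/
theorem sum_eq_of_cutWeight_eq [Fintype α] (h₁ : Laminar σ₁) (h₂ : Laminar σ₂) (hk : 3 ≤ k)
    (hkn : k < Fintype.card α)
    (hD : ∀ I : Finset α, I.card = k → cutWeight σ₁ w₁ I = cutWeight σ₂ w₂ I)
    (ne₁ : ∀ e, (σ₁ e).Nonempty ∧ σ₁ e ≠ univ) (ne₂ : ∀ e, (σ₂ e).Nonempty ∧ σ₂ e ≠ univ)
    (hp₁ : ∀ e, k ≤ (σ₁ e).card ∨ k ≤ (σ₁ e)ᶜ.card)
    (hp₂ : ∀ e, k ≤ (σ₂ e).card ∨ k ≤ (σ₂ e)ᶜ.card) :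
    ∑ e, w₁ e = ∑ e, w₂ e := by
  set g : Finset α → ℝ := fun B => splitWeight σ₁ w₁ univ B - splitWeight σ₂ w₂ univ B with hg
  set c : ℝ := ∑ e, w₁ e - ∑ e, w₂ e with hc
  have gcompl : ∀ B, g Bᶜ = g B := fun B => by
    simp only [hg, compl_eq_univ_sdiff, splitWeight_sdiff (subset_univ B)]
  have gsmall : ∀ B : Finset α, 2 ≤ B.card → k ≤ Bᶜ.card → g B = 0 := fun B hB hB' =>
    sub_eq_zero.2 (splitWeight_eq h₁ h₂ hk hD univ B (subset_univ B) hB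
      (by rwa [← compl_eq_univ_sdiff]))
  have gzero : ∀ B : Finset α, B.card ≠ 1 → Bᶜ.card ≠ 1 → g B = 0 := by
    intro B h1 h2
    by_contra hne
    have hor : splitWeight σ₁ w₁ univ B ≠ 0 ∨ splitWeight σ₂ w₂ univ B ≠ 0 := by
      by_contra! h
      exact hne (by simp only [hg, h.1, h.2, sub_zero])
    obtain ⟨h3, h4, h5⟩ := hor.elim (card_of_splitWeight_univ_ne_zero ne₁ hp₁)
      (card_of_splitWeight_univ_ne_zero ne₂ hp₂)
    rcases h5 with h5 | h5
    · exact hne (by rw [← gcompl]; exact gsmall Bᶜ (by omega) (by rwa [compl_compl]))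
    · exact hne (gsmall B (by omega) h5)
  -- The sum of `g` over all subsets is `2 * c`, each split being counted from both sides; only
  -- singletons and their complements contribute.
  have total : c = ∑ x, g {x} := by
    have h : ∑ A : Finset α, g A = 2 * c := by
      simp only [hg, sum_sub_distrib, sum_splitWeight_univ, hc]
      ring
    have h' : ∑ A : Finset α, g A = ∑ A : Finset α, (if A.card = 1 then g A else 0) +
        ∑ A : Finset α, (if Aᶜ.card = 1 then g Aᶜ else 0) := by
      rw [← sum_add_distrib]
      refine sum_congr rfl fun A _ => ?_
      rw [gcompl]
      have := card_add_card_compl A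
      by_cases h1 : A.card = 1
      · rw [if_pos h1, if_neg (by omega), add_zero]
      · by_cases h2 : Aᶜ.card = 1
        · rw [if_neg h1, if_pos h2, zero_add]
        · rw [if_neg h1, if_neg h2, gzero A h1 h2, add_zero]
    rw [sum_compl fun A => if A.card = 1 then g A else 0, sum_card_eq_one] at h'
    linarith
  -- Among the supersets of `I` only complements of singletons contribute: the supersets are too
  -- large to be singletons.
  have local_sum : ∀ I : Finset α, I.card = k → ∑ x ∈ Iᶜ, g {x} = c := by
    intro I hI
    have hne : I.Nonempty := card_pos.1 (by omega)
    have e₁ := sum_splitWeight_superset (σ := σ₁) (w := w₁) (subset_univ I) hne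
    have e₂ := sum_splitWeight_superset (σ := σ₂) (w := w₂) (subset_univ I) hne
    have h : ∑ A : Finset α, (if I ⊆ A then g A else 0) = c := by
      rw [← sum_filter, ← powerset_univ]
      simp only [hg, sum_sub_distrib]
      rw [e₁, e₂, hD I hI]
      ring
    rw [← h, ← sum_compl, sum_congr rfl (g := fun A => if A.card = 1 then
      (if I ⊆ Aᶜ then g A else 0) else 0), sum_card_eq_one, ← sum_filter]
    · refine sum_congr ?_ fun _ _ => rfl
      ext x
      simp only [mem_compl, mem_filter, mem_univ, true_and, subset_compl_singleton]
    · intro A _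
      rw [gcompl]
      split_ifs with h1 h2 h2
      · rfl
      · refine gzero A h2 fun h3 => ?_
        have := card_le_card h1
        omega
      · rfl
      · rfl
  have const : ∀ x y, g {x} = g {y} := by
    intro x y
    by_cases hxy : x = y
    · rw [hxy]
    have hcard : (univ \ {x, y} : Finset α).card = Fintype.card α - 2 := by
      rw [card_sdiff_of_subset (subset_univ _), card_pair hxy, card_univ]
    -- The size of `J` makes the complements of `insert x J` and `insert y J` both `k`-sets.
    obtain ⟨J, hJ, hJc⟩ := exists_subset_card_eq
      (show Fintype.card α - k - 1 ≤ (univ \ {x, y} : Finset α).card by omega)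
    have hx : x ∉ J := fun h => by simpa using hJ h
    have hy : y ∉ J := fun h => by simpa using hJ h
    have key : ∀ z ∉ J, g {z} + ∑ t ∈ J, g {t} = c := fun z hz => by
      rw [← local_sum (insert z J)ᶜ, compl_compl, sum_insert hz]
      rw [card_compl, card_insert_of_notMem hz]
      omega
    linarith [key x hx, key y hy]
  obtain ⟨I, -, hI⟩ := exists_subset_card_eq (show k ≤ (univ : Finset α).card from hkn.le)
  obtain ⟨z, -⟩ := card_pos.1 (show 0 < I.card by omega)
  have e₁ := local_sum I hI
  have e₂ := total
  rw [sum_congr rfl fun x _ => const x z, sum_const, nsmul_eq_mul, card_compl, hI,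
    Nat.cast_sub hkn.le] at e₁
  rw [sum_congr rfl fun x _ => const x z, sum_const, nsmul_eq_mul, card_univ] at e₂
  have hk0 : (k : ℝ) ≠ 0 := by positivity
  have hz : (k : ℝ) * g {z} = 0 := by linarith
  have hz' := (mul_eq_zero.1 hz).resolve_left hk0
  rw [hz', mul_zero] at e₂
  exact sub_eq_zero.1 e₂

end SplitSystem

/-! ### The split system of a marked tree -/

namespace MarkedTree

open Finset

variable {n k : ℕ} (T : MarkedTree.{u} n)

open Classical in
/-- The marks that the removal of an edge disconnects from the mark `r`. -/
noncomputable def side (r : Fin n) (e : T.graph.edgeSet) : Finset (Fin n) :=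
  {i | ¬ (T.graph.deleteEdges {(e : Sym2 T.V)}).Reachable (T.mark r) (T.mark i)}

lemma mem_side {r i : Fin n} {e : T.graph.edgeSet} :
    i ∈ T.side r e ↔
      ¬ (T.graph.deleteEdges {(e : Sym2 T.V)}).Reachable (T.mark r) (T.mark i) := by
  simp [side]

lemma laminar_side (r : Fin n) : SplitSystem.Laminar (T.side r) := by
  intro e f
  simp only [disjoint_left, subset_iff, mem_side, not_not]
  rcases T.isTree.connected.preconnected.not_reachable_laminar (T.mark r) e.2 f.2 with h | h | h
  · exact Or.inl fun i => h _
  · exact Or.inr (Or.inl fun i => h _)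
  · exact Or.inr (Or.inr fun i => h _)

lemma multiweight_eq_cutWeight (r : Fin n) {I : Finset (Fin n)} (hI : I.Nonempty) :
    T.multiweight (T.mark '' (I : Set (Fin n))) = SplitSystem.cutWeight (T.side r) T.w I := by
  classical
  rw [T.multiweight_eq_sum (hI.to_set.image _), SplitSystem.cutWeight]
  refine sum_congr rfl fun e _ => ?_
  have : T.Separates e (T.mark '' (I : Set (Fin n))) ↔
      ¬ I ⊆ T.side r e ∧ ¬ Disjoint I (T.side r e) := by
    simp only [WeightedTree.Separates, Set.exists_mem_image, mem_coe, disjoint_left, subset_iff,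
      mem_side, not_not]
    constructor
    · rintro ⟨i, hi, j, hj, hij⟩
      exact ⟨fun h => hij (T.isTree.connected.preconnected.reachable_of_not_reachable _ (h hi)
        (h hj)), fun h => hij ((h hi).symm.trans (h hj))⟩
    · rintro ⟨h, h'⟩
      push Not at h h'
      obtain ⟨i, hi, hi'⟩ := h
      obtain ⟨j, hj, hj'⟩ := h'
      exact ⟨i, hi, j, hj, fun hij => hj' (hi'.trans hij)⟩
  simp only [this]

variable {T}

/-- Both sides of an edge contain a leaf, hence a mark; and `r` is never cut off from itself. -/
lemma side_nonempty_and_ne_univ (hT : T.AllLeavesMarked) (r : Fin n) (e : T.graph.edgeSet) :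
    (T.side r e).Nonempty ∧ T.side r e ≠ univ := by
  have := T.finite
  constructor
  · by_contra hne
    rw [not_nonempty_iff_eq_empty] at hne
    have hall : ∀ x ∈ T.leaves,
        (T.graph.deleteEdges {(e : Sym2 T.V)}).Reachable (T.mark r) x := by
      intro x hx
      rw [hT] at hx
      obtain ⟨i, rfl⟩ := hx
      by_contra h
      have := T.mem_side.2 h
      simp [hne] at this
    obtain ⟨e, he⟩ := e
    induction e with | h a b =>
    obtain ⟨x, hx, hxb⟩ := T.isTree.exists_leaf_reachable he
    obtain ⟨y, hy, hya⟩ := T.isTree.exists_leaf_reachable (SimpleGraph.Adj.symm he)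
    rw [Sym2.eq_swap] at hya
    exact T.isTree.isAcyclic.not_reachable_deleteEdges he
      (hya.trans ((hall y hy).symm.trans ((hall x hx).trans hxb.symm)))
  · intro h
    exact T.mem_side.1 (h ▸ mem_univ r) .rfl

open Classical in
lemma ncard_leavesOnSide (hT : T.AllLeavesMarked) (u v : T.V) :
    (T.leavesOnSide u v).ncard =
      #{i | (T.graph.deleteEdges {s(u, v)}).Reachable u (T.mark i)} := by
  rw [← Set.ncard_coe_finset, ← Set.ncard_image_of_injective _ T.mark_injective]
  congr 1
  ext x
  have hx : x ∈ T.leaves ↔ x ∈ Set.range T.mark := by rw [hT]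
  simp only [WeightedTree.leavesOnSide, Set.mem_ofPred_eq, hx, coe_filter, mem_univ, true_and,
    Set.mem_image]
  constructor
  · rintro ⟨⟨i, rfl⟩, h⟩
    exact ⟨i, h, rfl⟩
  · rintro ⟨i, h, rfl⟩
    exact ⟨⟨i, rfl⟩, h⟩

lemma ncard_leavesOnSide_add (hT : T.AllLeavesMarked) {u v : T.V} (h : T.graph.Adj u v) :
    (T.leavesOnSide u v).ncard + (T.leavesOnSide v u).ncard = n := by
  classical
  rw [ncard_leavesOnSide hT, ncard_leavesOnSide hT, Sym2.eq_swap (a := v),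
    ← card_union_of_disjoint]
  · conv_rhs => rw [← Fintype.card_fin n, ← card_univ]
    congr 1
    ext i
    simpa using T.isTree.connected.preconnected.reachable_deleteEdges_or u v (T.mark i)
  · rw [disjoint_left]
    intro i hi hi'
    simp only [mem_filter, mem_univ, true_and] at hi hi'
    exact T.isTree.isAcyclic.not_reachable_deleteEdges h (hi.trans hi'.symm)

lemma ncard_leaves (hT : T.AllLeavesMarked) : T.leaves.ncard = n := by
  rw [hT, ← Set.image_univ, Set.ncard_image_of_injective _ T.mark_injective, Set.ncard_univ,
    Nat.card_fin]

lemma le_card_side_or (hT : T.AllLeavesMarked) (hp : T.IsPseudostar n k) (r : Fin n)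
    (e : T.graph.edgeSet) : k ≤ #(T.side r e) ∨ k ≤ #(T.side r e)ᶜ := by
  classical
  obtain ⟨e, he⟩ := e
  induction e with | h u v =>
  have key : ∀ a b, s(a, b) = s(u, v) → k ≤ (T.leavesOnSide a b).ncard →
      k ≤ #(T.side r ⟨s(u, v), he⟩) ∨ k ≤ #(T.side r ⟨s(u, v), he⟩)ᶜ := by
    intro a b hab hk
    rw [ncard_leavesOnSide hT, hab] at hk
    by_cases hr : (T.graph.deleteEdges {s(u, v)}).Reachable (T.mark r) a
    · right
      refine hk.trans (card_le_card fun i hi => ?_)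
      rw [mem_compl, mem_side, not_not]
      exact hr.trans (mem_filter.1 hi).2
    · left
      refine hk.trans (card_le_card fun i hi => ?_)
      rw [mem_side]
      exact fun h => hr (h.trans (mem_filter.1 hi).2.symm)
  rcases hp.2 u v he with h | h
  · exact key u v rfl h
  · exact key v u Sym2.eq_swap h

lemma isPseudostar_of_two_mul_le (hT : T.AllLeavesMarked) (hk : 2 * k ≤ n) :
    T.IsPseudostar n k := by
  refine ⟨ncard_leaves hT, fun u v h => ?_⟩
  have := ncard_leavesOnSide_add hT h
  omega

/-- Pseudostars with the same `k`-weights have the same total weight. -/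
theorem totalWeight_eq_of_isPseudostar (hk : 3 ≤ k) (hkn : k < n)
    {D : {I : Finset (Fin n) // I.card = k} → ℝ} {P Q : MarkedTree.{u} n}
    (hP : P ∈ realizations D) (hQ : Q ∈ realizations D) (hP' : P.IsPseudostar n k)
    (hQ' : Q.IsPseudostar n k) : P.totalWeight = Q.totalWeight := by
  let r : Fin n := ⟨0, by omega⟩
  rw [WeightedTree.totalWeight_eq_sum, WeightedTree.totalWeight_eq_sum]
  refine SplitSystem.sum_eq_of_cutWeight_eq (P.laminar_side r) (Q.laminar_side r) hk
    (by rwa [Fintype.card_fin]) (fun I hI => ?_) (side_nonempty_and_ne_univ hP.1 r)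
    (side_nonempty_and_ne_univ hQ.1 r) (le_card_side_or hP.1 hP' r) (le_card_side_or hQ.1 hQ' r)
  have hne : I.Nonempty := card_pos.1 (by omega)
  rw [← P.multiweight_eq_cutWeight r hne, ← Q.multiweight_eq_cutWeight r hne]
  exact (hP.2 ⟨I, hI⟩).trans (hQ.2 ⟨I, hI⟩).symm

/-! ### Shifting weight to an edge that divides every `k`-set -/

variable (T)

/-- The same marked tree with other weights. -/
def reweight (w : T.graph.edgeSet → ℝ) : MarkedTree.{u} n :=
  { T with w := w }

lemma exists_pendant_edge (i : Fin n) : ∃ e : T.graph.edgeSet,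
    (∀ f : T.graph.edgeSet, T.mark i ∈ (f : Sym2 T.V) ↔ f = e) ∧
    ∀ I : Finset (Fin n), 2 ≤ #I →
      (T.Separates e (T.mark '' (I : Set (Fin n))) ↔ i ∈ I) := by
  have hleaf := T.mark_mem_leaves i
  obtain ⟨b, hb⟩ := Set.ncard_eq_one.1 hleaf
  have hab : T.graph.Adj (T.mark i) b := by
    have : b ∈ T.graph.neighborSet (T.mark i) := hb ▸ Set.mem_singleton b
    exact this
  refine ⟨⟨s(T.mark i, b), hab⟩, fun f => ⟨fun hf => ?_, ?_⟩, fun I hI => ?_⟩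
  · obtain ⟨f, hf'⟩ := f
    obtain ⟨c, rfl⟩ := hf
    have : c ∈ T.graph.neighborSet (T.mark i) := hf'
    rw [hb, Set.mem_singleton_iff] at this
    subst this
    rfl
  · rintro rfl
    exact Sym2.mem_mk_left _ _
  · have iso : ∀ x, (T.graph.deleteEdges {s(T.mark i, b)}).Reachable (T.mark i) x ↔
        T.mark i = x := fun x =>
      SimpleGraph.reachable_deleteEdges_leaf_iff hleaf hab (Sym2.mem_mk_left _ _)
    simp only [WeightedTree.Separates, Set.exists_mem_image, mem_coe]
    constructor
    · rintro ⟨j, hj, l, hl, hjl⟩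
      by_contra hi
      refine hjl (T.isTree.connected.preconnected.reachable_of_not_reachable _
        (r := T.mark i) ?_ ?_) <;> rw [iso] <;> intro h <;> have := T.mark_injective h <;>
        subst this <;> contradiction
    · intro hi
      obtain ⟨j, hj, hji⟩ := exists_mem_ne (show 1 < #I by omega) i
      refine ⟨i, hi, j, hj, ?_⟩
      rw [iso]
      exact fun h => hji (T.mark_injective h).symm

open Classical in
/-- Increase the weight of one edge by `t` and decrease those of the pendant edges by `t / k`. -/
noncomputable def shiftWeight (k : ℕ) (e₀ : T.graph.edgeSet) (t : ℝ) : MarkedTree.{u} n :=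
  T.reweight fun e => T.w e + ((if e = e₀ then t else 0) -
    t / k * ∑ i, if T.mark i ∈ (e : Sym2 T.V) then 1 else 0)

lemma totalWeight_shiftWeight (e₀ : T.graph.edgeSet) (t : ℝ) :
    (T.shiftWeight k e₀ t).totalWeight = T.totalWeight + (t - t / k * n) := by
  classical
  rw [WeightedTree.totalWeight_eq_sum, WeightedTree.totalWeight_eq_sum]
  change ∑ e : T.graph.edgeSet, (T.w e + ((if e = e₀ then t else 0) -
    t / k * ∑ i, if T.mark i ∈ (e : Sym2 T.V) then 1 else 0)) = _
  rw [sum_add_distrib, sum_sub_distrib, sum_ite_eq', if_pos (mem_univ _), ← mul_sum, sum_comm]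
  congr 3
  have : ∀ i, ∑ e : T.graph.edgeSet, (if T.mark i ∈ (e : Sym2 T.V) then (1 : ℝ) else 0) = 1 := by
    intro i
    obtain ⟨e, he, -⟩ := T.exists_pendant_edge i
    simp only [he, sum_ite_eq', mem_univ, if_true]
  simp [this]

/-- The gain `t` at `e₀` is offset by the loss of `t / k` at the pendant edge of each of the `k`
marks in `I`; pendant edges of other marks do not separate `I`. -/
lemma multiweight_shiftWeight (hk : 2 ≤ k) {e₀ : T.graph.edgeSet} {I : Finset (Fin n)}
    (hI : #I = k) (h : T.Separates e₀ (T.mark '' (I : Set (Fin n)))) (t : ℝ) :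
    (T.shiftWeight k e₀ t).multiweight (T.mark '' (I : Set (Fin n))) =
      T.multiweight (T.mark '' (I : Set (Fin n))) := by
  classical
  have hne : (T.mark '' (I : Set (Fin n))).Nonempty :=
    (card_pos.1 (show 0 < #I by omega)).to_set.image _
  rw [T.multiweight_eq_sum hne]
  refine ((T.shiftWeight k e₀ t).multiweight_eq_sum hne).trans ?_
  set S : Set T.V := T.mark '' (I : Set (Fin n)) with hS
  change ∑ e : T.graph.edgeSet, (if T.Separates e S then
    (T.w e + ((if e = e₀ then t else 0) -
      t / k * ∑ i, if T.mark i ∈ (e : Sym2 T.V) then 1 else 0)) else 0) = _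
  have split : ∀ e : T.graph.edgeSet, (if T.Separates e S then
      (T.w e + ((if e = e₀ then t else 0) -
        t / k * ∑ i, if T.mark i ∈ (e : Sym2 T.V) then 1 else 0)) else 0) =
      (if T.Separates e S then T.w e else 0) + ((if e = e₀ then t else 0) -
        t / k * ∑ i, if T.mark i ∈ (e : Sym2 T.V) then (if T.Separates e S then 1 else 0)
          else 0) := by
    intro e
    by_cases hs : T.Separates e S
    · simp only [if_pos hs]
    · have : e ≠ e₀ := by rintro rfl; exact hs h
      simp [if_neg hs, this]
  rw [sum_congr rfl fun e _ => split e, sum_add_distrib, sum_sub_distrib, sum_ite_eq',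
    if_pos (mem_univ _), ← mul_sum, sum_comm]
  have : ∀ i, ∑ e : T.graph.edgeSet, (if T.mark i ∈ (e : Sym2 T.V) then
      (if T.Separates e S then (1 : ℝ) else 0) else 0) = if i ∈ I then 1 else 0 := by
    intro i
    obtain ⟨e, he, he'⟩ := T.exists_pendant_edge i
    simp only [he, sum_ite_eq', mem_univ, if_true, hS, he' I (by omega)]
  have hk0 : (k : ℝ) ≠ 0 := by positivity
  simp [this, hI, div_mul_cancel₀ t hk0]

variable {T}

/-- An edge violating the pseudostar condition has no side large enough to hold a `k`-set. -/
lemma exists_separating_edge (hT : T.AllLeavesMarked) (hp : ¬ T.IsPseudostar n k) :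
    ∃ e : T.graph.edgeSet, ∀ I : Finset (Fin n), #I = k →
      T.Separates e (T.mark '' (I : Set (Fin n))) := by
  classical
  simp only [WeightedTree.IsPseudostar, ncard_leaves hT, true_and] at hp
  push Not at hp
  obtain ⟨u, v, huv, h1, h2⟩ := hp
  refine ⟨⟨s(u, v), huv⟩, fun I hI => ?_⟩
  by_contra hsep
  simp only [WeightedTree.Separates, Set.exists_mem_image, mem_coe] at hsep
  push Not at hsep
  have key : ∀ a b, s(a, b) = s(u, v) → (T.leavesOnSide a b).ncard < k → ∀ i ∈ I,
      ¬ (T.graph.deleteEdges {s(u, v)}).Reachable a (T.mark i) := by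
    intro a b hab hlt i hi hai
    rw [ncard_leavesOnSide hT, hab, ← hI] at hlt
    refine absurd hlt (not_lt.2 (card_le_card fun j hj => ?_))
    rw [mem_filter]
    exact ⟨mem_univ j, hai.trans (hsep i hi j hj)⟩
  obtain ⟨i, hi⟩ := card_pos.1 (show 0 < #I by omega)
  rcases T.isTree.connected.preconnected.reachable_deleteEdges_or u v (T.mark i) with h | h
  · exact key u v rfl h1 i hi h
  · exact key v u Sym2.eq_swap h2 i hi h

/-- If a realization is not a pseudostar, the total weight can be prescribed arbitrarily. -/
theorem exists_totalWeight_eq (hk : 2 ≤ k) (hkn : k < n)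
    {D : {I : Finset (Fin n) // I.card = k} → ℝ} (hT : T ∈ realizations D)
    (hp : ¬ T.IsPseudostar n k) (x : ℝ) : ∃ Q ∈ realizations.{u} D, Q.totalWeight = x := by
  obtain ⟨e, he⟩ := exists_separating_edge hT.1 hp
  have hk0 : (k : ℝ) ≠ 0 := by positivity
  have hkn' : (k : ℝ) - n ≠ 0 := sub_ne_zero.2 (by exact_mod_cast hkn.ne)
  -- The parameter solves `t - t / k * n = x - T.totalWeight`.
  refine ⟨T.shiftWeight k e ((x - T.totalWeight) * k / (k - n)), ⟨hT.1, fun I => ?_⟩, ?_⟩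
  · exact (T.multiweight_shiftWeight hk I.2 (he I.1 I.2) _).trans (hT.2 I)
  · rw [totalWeight_shiftWeight]
    field_simp
    ring

end MarkedTree

/-! ### Pruning unmarked leaves -/

namespace SimpleGraph

variable {V W : Type*} {H : SimpleGraph V} {G : SimpleGraph W}

lemma Reachable.deleteEdges_map (φ : H →g G) (hφ : Function.Injective φ) {e : Sym2 V} {x y : V}
    (h : (H.deleteEdges {e}).Reachable x y) :
    (G.deleteEdges {e.map φ}).Reachable (φ x) (φ y) := by
  let ψ : H.deleteEdges {e} →g G.deleteEdges {e.map φ} :=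
    { toFun := φ
      map_rel' := fun {a b} hab => by
        rw [deleteEdges_adj, Set.mem_singleton_iff] at hab ⊢
        exact ⟨φ.map_adj hab.1, fun h => hab.2 (Sym2.map.injective hφ (by simpa using h))⟩ }
  exact h.map ψ

/-- If `e` separates `x` from `y`, they are joined to different ends of `e`; a path between their
images avoiding the image of `e` would then close a cycle in `G`. -/
lemma reachable_deleteEdges_map_iff (hH : H.Preconnected) (hG : G.IsAcyclic) (φ : H →g G)
    (hφ : Function.Injective φ) {e : Sym2 V} (he : e ∈ H.edgeSet) {x y : V} :
    (G.deleteEdges {e.map φ}).Reachable (φ x) (φ y) ↔ (H.deleteEdges {e}).Reachable x y := by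
  refine ⟨fun h => ?_, fun h => h.deleteEdges_map φ hφ⟩
  by_contra hne
  induction e with | h a b =>
  have hab : ¬ (G.deleteEdges {s(a, b).map φ}).Reachable (φ a) (φ b) :=
    hG.not_reachable_deleteEdges (φ.map_adj he)
  have key : ∀ z w, (H.deleteEdges {s(a, b)}).Reachable z w →
    (G.deleteEdges {s(a, b).map φ}).Reachable (φ z) (φ w) := fun z w h => h.deleteEdges_map φ hφ
  rcases hH.reachable_deleteEdges_or a b x with h1 | h1 <;>
  rcases hH.reachable_deleteEdges_or a b y with h2 | h2
  · exact hne (h1.symm.trans h2)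
  · exact hab (((key _ _ h1).trans h).trans (key _ _ h2).symm)
  · exact hab (((key _ _ h1).trans h).trans (key _ _ h2).symm).symm
  · exact hne (h1.symm.trans h2)

lemma Reachable.deleteEdges_of_notMem_range (φ : H →g G) {x y : V} (h : H.Reachable x y)
    {e : Sym2 W} (he : ∀ f ∈ H.edgeSet, f.map φ ≠ e) :
    (G.deleteEdges {e}).Reachable (φ x) (φ y) := by
  let ψ : H →g G.deleteEdges {e} :=
    { toFun := φ
      map_rel' := fun {a b} hab => by
        rw [deleteEdges_adj, Set.mem_singleton_iff]
        exact ⟨φ.map_adj hab, he s(a, b) hab⟩ }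
  exact h.map ψ

end SimpleGraph

namespace WeightedTree

/-- Edges outside the image of `φ` separate no two image points, and edges in the image separate
exactly as in the smaller tree. -/
lemma multiweight_image_hom {T T' : WeightedTree.{u}} (φ : T'.graph →g T.graph)
    (hφ : Function.Injective φ) (hw : ∀ e, T'.w e = T.w (φ.mapEdgeSet e)) {S : Set T'.V}
    (hS : S.Nonempty) : T.multiweight (φ '' S) = T'.multiweight S := by
  classical
  rw [T.multiweight_eq_sum (hS.image _), T'.multiweight_eq_sum hS]
  symm
  refine Fintype.sum_of_injective φ.mapEdgeSet (SimpleGraph.Hom.mapEdgeSet.injective φ hφ) _ _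
    (fun e he => if_neg ?_) fun e => ?_
  · simp only [Separates, Set.exists_mem_image]
    rintro ⟨x, -, y, -, hxy⟩
    exact hxy ((T'.isTree.connected.preconnected x y).deleteEdges_of_notMem_range φ
      fun f hf hfe => he ⟨⟨f, hf⟩, Subtype.ext hfe⟩)
  · have : T.Separates (φ.mapEdgeSet e) (φ '' S) ↔ T'.Separates e S := by
      simp only [Separates, Set.exists_mem_image]
      refine exists_congr fun x => and_congr_right fun _ => exists_congr fun y =>
        and_congr_right fun _ => not_congr ?_
      exact SimpleGraph.reachable_deleteEdges_map_iff T'.isTree.connected.preconnected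
        T.isTree.isAcyclic φ hφ e.2
    simp only [this, hw]

end WeightedTree

namespace MarkedTree

variable {n k : ℕ}

lemma exists_prune_leaf (T : MarkedTree.{u} n) (hn : 2 ≤ n) (hT : ¬ T.AllLeavesMarked) :
    ∃ T' : MarkedTree.{u} n, Nat.card T'.V < Nat.card T.V ∧ ∀ I : Set (Fin n), I.Nonempty →
      T'.multiweight (T'.mark '' I) = T.multiweight (T.mark '' I) := by
  classical
  have hfin := T.finite
  have := Fintype.ofFinite T.V
  obtain ⟨v, hv, hvm⟩ : ∃ v ∈ T.leaves, v ∉ Set.range T.mark := by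
    by_contra! h
    exact hT (Set.Subset.antisymm h (by rintro _ ⟨i, rfl⟩; exact T.mark_mem_leaves i))
  let φ : T.graph.induce {v}ᶜ →g T.graph := (SimpleGraph.Embedding.induce {v}ᶜ).toHom
  have hφ : Function.Injective φ := Subtype.val_injective
  have hconn : (T.graph.induce {v}ᶜ).Connected := by
    refine T.isTree.connected.induce_compl_singleton_of_degree_eq_one ?_
    rw [← SimpleGraph.card_neighborSet_eq_degree, ← Nat.card_eq_fintype_card]
    exact hv
  let T₀ : WeightedTree.{u} :=
    { V := ({v}ᶜ : Set T.V)
      finite := inferInstance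
      graph := T.graph.induce {v}ᶜ
      isTree := ⟨hconn, T.isTree.isAcyclic.comap φ hφ⟩
      w := fun e => T.w (φ.mapEdgeSet e) }
  let m : Fin n → ({v}ᶜ : Set T.V) := fun i => ⟨T.mark i, fun h => hvm ⟨i, h⟩⟩
  have hm : Function.Injective m := fun i j h => T.mark_injective (congrArg Subtype.val h)
  let T' : MarkedTree.{u} n :=
    { T₀ with
      mark := m
      mark_injective := hm
      -- A mark keeps at most its one neighbour; it keeps it because the pruned tree is connected
      -- and, as `2 ≤ n`, contains another mark.
      mark_mem_leaves := by
        intro i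
        obtain ⟨b, hb⟩ := Set.ncard_eq_one.1 (T.mark_mem_leaves i)
        have : Nontrivial (Fin n) := Fin.nontrivial_iff_two_le.2 hn
        obtain ⟨j, hj⟩ := exists_ne i
        obtain ⟨p⟩ := hconn.preconnected (m i) (m j)
        have hnil : m i ≠ m j := fun h => hj (hm h).symm
        generalize m j = z at p hnil
        cases p with
        | nil => exact absurd rfl hnil
        | @cons _ c _ h _ =>
          refine Set.ncard_eq_one.2 ⟨c, Set.eq_singleton_iff_unique_mem.2 ⟨h, fun d hd => ?_⟩⟩
          have h1 : φ c ∈ T.graph.neighborSet (T.mark i) := φ.map_adj h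
          have h2 : φ d ∈ T.graph.neighborSet (T.mark i) := φ.map_adj hd
          rw [hb, Set.mem_singleton_iff] at h1 h2
          exact hφ (h2.trans h1.symm) }
  refine ⟨T', ?_, fun I hI => ?_⟩
  · change Nat.card ({v}ᶜ : Set T.V) < Nat.card T.V
    rw [Nat.card_eq_fintype_card, Nat.card_eq_fintype_card]
    exact Fintype.card_subtype_lt (x := v) (by simp)
  · have h := WeightedTree.multiweight_image_hom (T := T.toWeightedTree)
      (T' := T'.toWeightedTree) φ hφ (fun _ => rfl) (hI.image T'.mark)
    rw [← h, Set.image_image]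
    rfl

/-- Every l-treelike family is realized by a tree without further leaves. -/
theorem realizations_nonempty (hn : 2 ≤ n) (hk : 1 ≤ k)
    {D : {I : Finset (Fin n) // I.card = k} → ℝ} (hD : IsLTreelike.{u} D) :
    (realizations.{u} D).Nonempty := by
  obtain ⟨T, hT⟩ := hD
  induction hN : Nat.card T.V using Nat.strong_induction_on generalizing T with
  | _ N ih =>
  by_cases hall : T.AllLeavesMarked
  · exact ⟨T, hall, hT⟩
  · obtain ⟨T', hlt, hT'⟩ := T.exists_prune_leaf hn hall
    refine ih _ (hN ▸ hlt) T' (fun I => ?_) rfl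
    rw [hT' _ (Finset.card_pos.1 (by rw [I.2]; omega)).to_set]
    exact hT I

end MarkedTree

theorem theorem4p2 (n k : ℕ) (hk : 3 ≤ k) (hkn : k < n)
    (D : {I : Finset (Fin n) // I.card = k} → ℝ) (hD : IsLTreelike.{u} D) :
    ((∀ T ∈ realizations.{u} D, T.IsPseudostar n k) →
      (∀ P ∈ realizations.{u} D, ∀ P' ∈ realizations.{u} D, P.totalWeight = P'.totalWeight) ∧
      (⨅ P ∈ realizations.{u} D, ((P.totalWeight : ℝ) : EReal)) =
        ⨆ P ∈ realizations.{u} D, ((P.totalWeight : ℝ) : EReal)) ∧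
    ((k : ℝ) ≤ (n : ℝ) / 2 → ∀ T ∈ realizations.{u} D, T.IsPseudostar n k) ∧
    ((∃ T ∈ realizations.{u} D, ¬ T.IsPseudostar n k) →
      (⨅ T ∈ realizations.{u} D, ((T.totalWeight : ℝ) : EReal)) = ⊥ ∧
      (⨆ T ∈ realizations.{u} D, ((T.totalWeight : ℝ) : EReal)) = ⊤) := by
  refine ⟨fun hps => ?_, fun hkn2 T hT => ?_, ?_⟩
  · have heq : ∀ P ∈ realizations.{u} D, ∀ P' ∈ realizations.{u} D,
        P.totalWeight = P'.totalWeight := fun P hP Q hQ =>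
      MarkedTree.totalWeight_eq_of_isPseudostar hk hkn hP hQ (hps P hP) (hps Q hQ)
    refine ⟨heq, ?_⟩
    -- Over an empty set the infimum would be `⊤` and the supremum `⊥`, so a realization must exist.
    have hne := MarkedTree.realizations_nonempty (by omega) (by omega) hD
    obtain ⟨Q, hQ⟩ := hne
    have h : ∀ P ∈ realizations.{u} D, ((P.totalWeight : ℝ) : EReal) = (Q.totalWeight : ℝ) :=
      fun P hP => by rw [heq P hP Q hQ]
    rw [biInf_congr h, biSup_congr h, biInf_const ⟨Q, hQ⟩, biSup_const ⟨Q, hQ⟩]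
  · refine MarkedTree.isPseudostar_of_two_mul_le hT.1 ?_
    have : (2 * k : ℝ) ≤ n := by linarith
    exact_mod_cast this
  · rintro ⟨T, hT, hp⟩
    have hex := MarkedTree.exists_totalWeight_eq (by omega) hkn hT hp
    constructor
    · rw [EReal.eq_bot_iff_forall_lt]
      intro y
      obtain ⟨Q, hQ, hx⟩ := hex (y - 1)
      refine (iInf₂_le Q hQ).trans_lt ?_
      rw [hx, EReal.coe_lt_coe_iff]
      linarith
    · rw [EReal.eq_top_iff_forall_lt]
      intro y
      obtain ⟨Q, hQ, hx⟩ := hex (y + 1)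
      refine lt_of_lt_of_le ?_ (le_iSup₂ (f := fun (P : MarkedTree.{u} n)
        (_ : P ∈ realizations.{u} D) => ((P.totalWeight : ℝ) : EReal)) Q hQ)
      rw [hx, EReal.coe_lt_coe_iff]
      linarith
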